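/- Let $f_0=0$, $f_1=1$, $f_{n+1}=f_n+f_{n-1}$ be the Fibonacci numbers and $\tau=\frac{1+\sqrt5}{2}$ the golden mean. Consider the random substitution $\mathtt a\mapsto\mathtt{baa}$, $\mathtt b\mapsto\mathtt{ab}$ or $\mathtt{ba}$ (chosen independently at each occurrence of $\mathtt b$, each with positive probability) on words over $\{\mathtt a,\mathtt b\}$. Its sets of inflated words in generation $n$, starting from $\mathtt a$ and from $\mathtt b$, are given by $A_1=\{\mathtt a\}$, $B_1=\{\mathtt b\}$ and, for $n\ge2$, $$A_n=B_{n-1}A_{n-1}A_{n-1},\qquad B_n=A_{n-1}B_{n-1}\cup B_{n-1}A_{n-1},$$ where $UV=\{uv:u\in U,\,v\in V\}$. Let $A=\lim_{n\to\infty}A_n$ and $B=\lim_{n\to\infty}B_n$ be the limit sets, consisting of the one-sided infinite words each of whose finite prefixes is a prefix of some word in $A_n$ (respectively $B_n$) for all sufficiently large $n$. For a set $S$ of infinite words let $F(S,n)$ be the set of all sub-words (blocks of consecutive letters) of length $n$ of words in $S$. Then, for $C\in\{A,B\}$, $$\lim_{n\to\infty}\frac{\log|A_n|}{f_{2n}}=\lim_{n\to\infty}\frac{\log|B_n|}{f_{2n-1}}=\lim_{n\to\infty}\frac{\log|F(C,n)|}{n}=\frac{1}{\tau^3}\log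 2,$$ where all the limits exist. Moreover, this number is the topological entropy of the shift map on the two-sided subshift of all bi-infinite words over $\{\mathtt a,\mathtt b\}$ all of whose finite sub-words of each length $n$ belong to $F(C,n)$. In particular, the topological entropy equals the growth rate of the sets of inflated words. -/

import Mathlib

namespace RandomFibonacci

/-- The alphabet with the two letters a and b. -/
inductive Letter : Type
  | a
  | b

/-- The alphabet carries the discrete uniformity. -/
instance : UniformSpace Letter := ⊥

/-- The pair of the sets of inflated words in generation `n` (starting from the letter `a` and from
the letter `b`, respectively). Generations are counted from `1`; the value at `0` is a dummy.
The operations `*` and `+` on `Language` are the product (all concatenations) and the union. -/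
def inflated : ℕ → Language Letter × Language Letter
  | 0 => (0, 0)
  | 1 => ({[Letter.a]}, {[Letter.b]})
  | n + 2 =>
    let p := inflated (n + 1)
    (p.2 * p.1 * p.1, p.1 * p.2 + p.2 * p.1)

/-- The set `A n` of inflated words in generation `n ≥ 1`. -/
def A (n : ℕ) : Set (List Letter) := (inflated n).1

/-- The set `B n` of inflated words in generation `n ≥ 1`. -/
def B (n : ℕ) : Set (List Letter) := (inflated n).2

/-- The limit of a sequence of sets of finite words, as a set of infinite words: an infinite word
belongs to it iff each of its prefixes is, for all large `n`, a prefix of a word in `S n`. -/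
def limitSet (S : ℕ → Set (List Letter)) : Set (ℕ → Letter) :=
  {w | ∀ k : ℕ, ∀ᶠ n in Filter.atTop, ∃ v ∈ S n, List.ofFn (fun j : Fin k => w j) <+: v}

/-- The limit set of the sets `A n`. -/
def limA : Set (ℕ → Letter) := limitSet A

/-- The limit set of the sets `B n`. -/
def limB : Set (ℕ → Letter) := limitSet B

/-- The words of `B n` have length at least `n`, and `A n`, `B n` are non-empty, for `n ≥ 1`. -/
theorem inflated_aux (n : ℕ) :
    (A (n + 1)).Nonempty ∧ (B (n + 1)).Nonempty ∧
      (∀ v ∈ A (n + 1), n + 1 ≤ v.length) ∧ (∀ v ∈ B (n + 1), n + 1 ≤ v.length) := by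
  induction n with
  | zero =>
    refine ⟨⟨[Letter.a], rfl⟩, ⟨[Letter.b], rfl⟩, ?_, ?_⟩ <;> rintro v rfl <;> simp
  | succ n ih =>
    obtain ⟨⟨x, hx⟩, ⟨y, hy⟩, hA, hB⟩ := ih
    refine ⟨⟨y ++ x ++ x, ⟨y ++ x, ⟨y, hy, x, hx, rfl⟩, x, hx, rfl⟩⟩,
      ⟨y ++ x, Or.inr ⟨y, hy, x, hx, rfl⟩⟩, ?_, ?_⟩
    · rintro v ⟨w, ⟨b, hb, a, ha, rfl⟩, a', ha', rfl⟩
      have h1 := hA a ha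
      have h2 := hB b hb
      simp only [List.length_append]
      omega
    · rintro v (⟨a, ha, b, hb, rfl⟩ | ⟨b, hb, a, ha, rfl⟩) <;>
      · have h1 := hA a ha
        have h2 := hB b hb
        simp only [List.length_append]
        omega

/-- Prefixes of words in `B n` persist in all later generations. -/
theorem prefix_B_mono {p : List Letter} {n m : ℕ} (hnm : n ≤ m)
    (h : ∃ v ∈ B (n + 1), p <+: v) : ∃ v ∈ B (m + 1), p <+: v := by
  induction m, hnm using Nat.le_induction with
  | base => exact h
  | succ m _ ih =>
    obtain ⟨v, hv, hp⟩ := ih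
    obtain ⟨x, hx⟩ := (inflated_aux m).1
    exact ⟨v ++ x, Or.inr ⟨v, hv, x, hx, rfl⟩, hp.trans (List.prefix_append _ _)⟩

/-- A word that is a prefix in infinitely many `B n` is one for all large `n`: the sequence `B n`
converges. -/
theorem limB_wellDefined (p : List Letter)
    (h : ∃ᶠ n in Filter.atTop, ∃ v ∈ B n, p <+: v) :
    ∀ᶠ n in Filter.atTop, ∃ v ∈ B n, p <+: v := by
  obtain ⟨n, hn, hv⟩ := Filter.frequently_atTop.1 h 1
  obtain ⟨n, rfl⟩ := Nat.exists_eq_add_of_le' hn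
  refine Filter.eventually_atTop.2 ⟨n + 1, fun m hm => ?_⟩
  obtain ⟨m, rfl⟩ := Nat.exists_eq_add_of_le' (le_trans (Nat.le_add_left 1 n) hm)
  exact prefix_B_mono (by omega) hv

/-- A word that is a prefix in infinitely many `A n` is one for all large `n`: the sequence `A n`
converges. -/
theorem limA_wellDefined (p : List Letter)
    (h : ∃ᶠ n in Filter.atTop, ∃ v ∈ A n, p <+: v) :
    ∀ᶠ n in Filter.atTop, ∃ v ∈ A n, p <+: v := by
  obtain ⟨n, hn, v, hv, hp⟩ := Filter.frequently_atTop.1 h (p.length + 2)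
  obtain ⟨n, rfl⟩ := Nat.exists_eq_add_of_le' (le_trans (Nat.le_add_left 2 _) hn)
  obtain ⟨w, ⟨b, hb, a, ha, rfl⟩, a', ha', rfl⟩ := hv
  have hl := (inflated_aux n).2.2.2 b hb
  have hpb : p <+: b := by
    refine List.prefix_of_prefix_length_le hp ?_ (by omega)
    exact (List.prefix_append b a).trans (List.prefix_append (b ++ a) a')
  refine Filter.eventually_atTop.2 ⟨n + 2, fun m hm => ?_⟩
  obtain ⟨m, rfl⟩ := Nat.exists_eq_add_of_le' (le_trans (Nat.le_add_left 2 n) hm)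
  obtain ⟨v, hv, hpv⟩ := prefix_B_mono (m := m) (by omega) ⟨b, hb, hpb⟩
  obtain ⟨x, hx⟩ := (inflated_aux m).1
  exact ⟨v ++ x ++ x, ⟨v ++ x, ⟨v, hv, x, hx, rfl⟩, x, hx, rfl⟩,
    hpv.trans ((List.prefix_append v x).trans (List.prefix_append (v ++ x) x))⟩

/-- The set of all sub-words of length `n` of the infinite words in `S`. -/
def F (S : Set (ℕ → Letter)) (n : ℕ) : Set (List Letter) :=
  {x | ∃ w ∈ S, ∃ i : ℕ, x = List.ofFn (fun j : Fin n => w (i + j))}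

/-- The two-sided subshift of all bi-infinite words whose finite sub-words are all sub-words of
words in `S`. -/
def subshift (S : Set (ℕ → Letter)) : Set (ℤ → Letter) :=
  {x | ∀ (i : ℤ) (n : ℕ), List.ofFn (fun j : Fin n => x (i + j)) ∈ F S n}

/-- The left shift on bi-infinite words. -/
def shift (x : ℤ → Letter) : ℤ → Letter := fun i => x (i + 1)

end RandomFibonacci

namespace RandomFibonacci

open Letter
open scoped Computability

/-! Words in $A_n$ and $B_n$ have the fixed lengths $f_{2n}$ and $f_{2n-1}$, so concatenations split
uniquely and cardinalities multiply, once the two products forming $B_n$ are known to be disjoint.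
They are, since desubstitution is unique (`wordImage_injective`): a common word would descend to the
equality of ab and ba (`disjoint_products`). The recursions give $|A_{n+2}|=2^{f_{2n+1}-1}$ and
$|B_{n+2}|=2^{f_{2n}+1}$ (`ncard_inflated`). These exponents lag the lengths by three Fibonacci
indices, whence the rate $h=\tau^{-3}\log 2$.

The two limit sets coincide, and the limit of $\log|F(n)|/n$ exists by subadditivity. It is at least
$h$ because $A_n\subseteq F(f_{2n})$. For the upper bound, fix a generation $k$: every sub-word is,
up to bounded overhang, a concatenation of words from $A_k\cup B_k$. There are at most $e^{\theta
M}$ such concatenations of length $M$ if $|A_k|e^{-\theta f_{2k}}+|B_k|e^{-\theta f_{2k-1}}\le1$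
(`ncard_kstar_le`), and for each $\theta>h$ this holds once $k$ is large.

For the entropy, minimal dynamical covers are compared with numbers of words
(`coverMincard_cylinder_le`, `ncard_F_le_coverMincard`); the lower bound needs every sub-word to
occur in the subshift (`exists_mem_subshift`). -/

/-! ### Recursion and word lengths. -/

theorem A_succ_succ (n : ℕ) :
    A (n + 2) = {x | ∃ b ∈ B (n + 1), ∃ a ∈ A (n + 1), ∃ a' ∈ A (n + 1), x = b ++ a ++ a'} := by
  ext x
  constructor
  · rintro ⟨w, ⟨b, hb, a, ha, rfl⟩, a', ha', rfl⟩
    exact ⟨b, hb, a, ha, a', ha', rfl⟩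
  · rintro ⟨b, hb, a, ha, a', ha', rfl⟩
    exact ⟨b ++ a, ⟨b, hb, a, ha, rfl⟩, a', ha', rfl⟩

theorem B_succ_succ (n : ℕ) :
    B (n + 2) = Set.image2 (· ++ ·) (A (n + 1)) (B (n + 1)) ∪
      Set.image2 (· ++ ·) (B (n + 1)) (A (n + 1)) := rfl

theorem append_mem_A {n : ℕ} {b a a' : List Letter} (hb : b ∈ B (n + 1)) (ha : a ∈ A (n + 1))
    (ha' : a' ∈ A (n + 1)) : b ++ a ++ a' ∈ A (n + 2) := by
  rw [A_succ_succ]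
  exact ⟨b, hb, a, ha, a', ha', rfl⟩

theorem append_mem_B_left {n : ℕ} {a b : List Letter} (ha : a ∈ A (n + 1)) (hb : b ∈ B (n + 1)) :
    a ++ b ∈ B (n + 2) := Or.inl ⟨a, ha, b, hb, rfl⟩

theorem append_mem_B_right {n : ℕ} {a b : List Letter} (ha : a ∈ A (n + 1)) (hb : b ∈ B (n + 1)) :
    b ++ a ∈ B (n + 2) := Or.inr ⟨b, hb, a, ha, rfl⟩

theorem length_inflated (n : ℕ) :
    (∀ v ∈ A (n + 1), v.length = Nat.fib (2 * n + 2)) ∧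
      (∀ v ∈ B (n + 1), v.length = Nat.fib (2 * n + 1)) := by
  induction n with
  | zero => constructor <;> rintro v rfl <;> simp
  | succ n ih =>
    have h1 : Nat.fib (2 * (n + 1) + 1) = Nat.fib (2 * n + 1) + Nat.fib (2 * n + 2) :=
      Nat.fib_add_two
    have h2 : Nat.fib (2 * (n + 1) + 2) = Nat.fib (2 * n + 2) + Nat.fib (2 * (n + 1) + 1) :=
      Nat.fib_add_two
    constructor
    · intro v hv
      rw [A_succ_succ] at hv
      obtain ⟨b, hb, a, ha, a', ha', rfl⟩ := hv
      simp only [List.length_append, ih.1 a ha, ih.1 a' ha', ih.2 b hb]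
      omega
    · rintro v (⟨a, ha, b, hb, rfl⟩ | ⟨b, hb, a, ha, rfl⟩) <;>
      · simp only [List.length_append, ih.1 a ha, ih.2 b hb]
        omega

/-! ### Unique desubstitution and disjointness. -/

/-- The possible images of a letter under the random substitution. -/
def letterImage : Letter → Language Letter
  | a => {[b, a, a]}
  | b => {[a, b], [b, a]}

/-- The possible images of a word under the random substitution. -/
def wordImage (u : List Letter) : Language Letter := (u.map letterImage).prod

theorem append_mem_wordImage {u v x y : List Letter} (hx : x ∈ wordImage u)
    (hy : y ∈ wordImage v) : x ++ y ∈ wordImage (u ++ v) := by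
  rw [wordImage, List.map_append, List.prod_append]
  exact ⟨x, hx, y, hy, rfl⟩

theorem mem_wordImage_concat {u x : List Letter} {c : Letter} :
    x ∈ wordImage (u ++ [c]) ↔ ∃ y ∈ wordImage u, ∃ z ∈ letterImage c, y ++ z = x := by
  simp only [wordImage, List.map_append, List.prod_append, List.map_cons, List.map_nil,
    List.prod_singleton, Language.mem_mul]

/-- The letter images form a suffix code. -/
theorem letterImage_suffix_code {c d : Letter} {x y z z' : List Letter} (hz : z ∈ letterImage c)
    (hz' : z' ∈ letterImage d) (h : x ++ z = y ++ z') : c = d ∧ x = y := by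
  -- The blocks baa, ab, ba differ in their last two letters; reversing brings these to the front.
  have h' := congrArg List.reverse h
  have key : ∀ {c z}, z ∈ letterImage c → (c = a ∧ z = [b, a, a]) ∨ (c = b ∧ z = [a, b]) ∨
      (c = b ∧ z = [b, a]) := by
    rintro (_ | _) z hz
    · exact Or.inl ⟨rfl, hz⟩
    · rcases hz with hz | hz
      · exact Or.inr (Or.inl ⟨rfl, hz⟩)
      · exact Or.inr (Or.inr ⟨rfl, hz⟩)
  rcases key hz with ⟨rfl, rfl⟩ | ⟨rfl, rfl⟩ | ⟨rfl, rfl⟩ <;>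
  rcases key hz' with ⟨rfl, rfl⟩ | ⟨rfl, rfl⟩ | ⟨rfl, rfl⟩ <;>
  simp at h' ⊢ <;>
  exact h'

theorem ne_nil_of_mem_letterImage {c : Letter} {z : List Letter} (hz : z ∈ letterImage c) :
    z ≠ [] := by
  cases c
  · rintro rfl; cases hz
  · rintro rfl; rcases hz with hz | hz <;> cases hz

/-- Every word arises from at most one word under the random substitution. -/
theorem wordImage_injective {u v x : List Letter} (hu : x ∈ wordImage u) (hv : x ∈ wordImage v) :
    u = v := by
  induction u using List.reverseRecOn generalizing v x with
  | nil =>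
    obtain rfl : x = [] := hu
    rcases List.eq_nil_or_concat v with rfl | ⟨v, c, rfl⟩
    · rfl
    · obtain ⟨y, -, z, hz, h⟩ := mem_wordImage_concat.1 (by simpa using hv)
      exact absurd (List.append_eq_nil_iff.1 h).2 (ne_nil_of_mem_letterImage hz)
  | append_singleton u c ih =>
    obtain ⟨y, hy, z, hz, rfl⟩ := mem_wordImage_concat.1 hu
    rcases List.eq_nil_or_concat v with rfl | ⟨v, d, rfl⟩
    · exact absurd (List.append_eq_nil_iff.1 (show y ++ z = [] from hv)).2
        (ne_nil_of_mem_letterImage hz)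
    · rw [List.concat_eq_append] at hv ⊢
      obtain ⟨y', hy', z', hz', h⟩ := mem_wordImage_concat.1 hv
      obtain ⟨rfl, rfl⟩ := letterImage_suffix_code hz' hz h
      rw [ih hy hy']

/-- The recursion concatenates words of the previous generation, while the substitution acts on
single letters. Since the substitution respects concatenation, the second description follows from
the first by induction. -/
theorem exists_preimage_of_mem_inflated (n : ℕ) :
    (∀ x ∈ A (n + 2), ∃ u ∈ A (n + 1), x ∈ wordImage u) ∧
      (∀ x ∈ B (n + 2), ∃ u ∈ B (n + 1), x ∈ wordImage u) := by
  have single : ∀ {c x}, x ∈ letterImage c → x ∈ wordImage [c] := fun {c x} h => by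
    simpa [wordImage] using h
  induction n with
  | zero =>
    constructor
    · intro x hx
      rw [A_succ_succ] at hx
      obtain ⟨_, rfl, _, rfl, _, rfl, rfl⟩ := hx
      exact ⟨[a], rfl, single rfl⟩
    · rintro x (⟨_, rfl, _, rfl, rfl⟩ | ⟨_, rfl, _, rfl, rfl⟩)
      · exact ⟨[b], rfl, single (Or.inl rfl)⟩
      · exact ⟨[b], rfl, single (Or.inr rfl)⟩
  | succ n ih =>
    constructor
    · intro x hx
      rw [A_succ_succ] at hx
      obtain ⟨y, hy, z, hz, z', hz', rfl⟩ := hx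
      obtain ⟨u, hu, hyu⟩ := ih.2 y hy
      obtain ⟨v, hv, hzv⟩ := ih.1 z hz
      obtain ⟨v', hv', hzv'⟩ := ih.1 z' hz'
      exact ⟨_, append_mem_A hu hv hv',
        append_mem_wordImage (append_mem_wordImage hyu hzv) hzv'⟩
    · rintro x (⟨y, hy, z, hz, rfl⟩ | ⟨z, hz, y, hy, rfl⟩) <;>
      obtain ⟨u, hu, hyu⟩ := ih.1 y hy <;>
      obtain ⟨v, hv, hzv⟩ := ih.2 z hz
      · exact ⟨_, append_mem_B_left hu hv, append_mem_wordImage hyu hzv⟩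
      · exact ⟨_, append_mem_B_right hu hv, append_mem_wordImage hzv hyu⟩

theorem disjoint_products (n : ℕ) :
    Disjoint (Set.image2 (· ++ ·) (A (n + 1)) (B (n + 1)))
      (Set.image2 (· ++ ·) (B (n + 1)) (A (n + 1))) := by
  induction n with
  | zero =>
    rw [Set.disjoint_left]
    rintro _ ⟨_, rfl, _, rfl, rfl⟩ ⟨_, rfl, _, rfl, h⟩
    cases h
  | succ n ih =>
    rw [Set.disjoint_left] at ih ⊢
    rintro _ ⟨x, hx, y, hy, rfl⟩ ⟨y', hy', x', hx', h⟩
    obtain ⟨u, hu, hxu⟩ := (exists_preimage_of_mem_inflated n).1 x hx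
    obtain ⟨v, hv, hyv⟩ := (exists_preimage_of_mem_inflated n).2 y hy
    obtain ⟨u', hu', hxu'⟩ := (exists_preimage_of_mem_inflated n).1 x' hx'
    obtain ⟨v', hv', hyv'⟩ := (exists_preimage_of_mem_inflated n).2 y' hy'
    have h1 := append_mem_wordImage hyv' hxu'
    rw [show y' ++ x' = x ++ y from h] at h1
    have h2 := wordImage_injective h1 (append_mem_wordImage hxu hyv)
    exact ih ⟨u, hu, v, hv, rfl⟩ ⟨v', hv', u', hu', h2⟩

/-! ### Cardinalities of the sets of inflated words. -/

theorem ncard_image2_append {S T : Set (List Letter)} {k : ℕ} (hS : ∀ v ∈ S, v.length = k) :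
    (Set.image2 (· ++ ·) S T).ncard = S.ncard * T.ncard := by
  rw [← Set.image_prod, Set.InjOn.ncard_image, Set.ncard_prod]
  rintro ⟨x, y⟩ ⟨hx, -⟩ ⟨x', y'⟩ ⟨hx', -⟩ h
  obtain ⟨h1, h2⟩ := List.append_inj h ((hS x hx).trans (hS x' hx').symm)
  exact Prod.ext h1 h2

instance : Finite Letter :=
  Finite.of_surjective (fun t : Bool => if t then a else b)
    (by rintro (_ | _); exacts [⟨true, rfl⟩, ⟨false, rfl⟩])

theorem finite_of_length_eq {S : Set (List Letter)} {k : ℕ} (hS : ∀ v ∈ S, v.length = k) :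
    S.Finite :=
  (List.finite_length_eq Letter k).subset hS

theorem finite_A (n : ℕ) : (A (n + 1)).Finite := finite_of_length_eq (length_inflated n).1

theorem finite_B (n : ℕ) : (B (n + 1)).Finite := finite_of_length_eq (length_inflated n).2

theorem ncard_A_succ_succ (n : ℕ) :
    (A (n + 2)).ncard = (B (n + 1)).ncard * (A (n + 1)).ncard * (A (n + 1)).ncard := by
  have h : A (n + 2) = Set.image2 (· ++ ·)
      (Set.image2 (· ++ ·) (B (n + 1)) (A (n + 1))) (A (n + 1)) := rfl
  rw [h, ncard_image2_append (k := Nat.fib (2 * n + 1) + Nat.fib (2 * n + 2)),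
    ncard_image2_append (length_inflated n).2]
  rintro _ ⟨x, hx, y, hy, rfl⟩
  simp [(length_inflated n).2 x hx, (length_inflated n).1 y hy]

theorem ncard_B_succ_succ (n : ℕ) :
    (B (n + 2)).ncard = 2 * ((A (n + 1)).ncard * (B (n + 1)).ncard) := by
  rw [B_succ_succ, Set.ncard_union_eq (disjoint_products n) ((finite_A n).image2 _ (finite_B n))
    ((finite_B n).image2 _ (finite_A n)), ncard_image2_append (length_inflated n).1,
    ncard_image2_append (length_inflated n).2]
  ring

/-- The factor 2 on the left avoids the truncated exponent $f_{2n+1}-1$. -/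
theorem ncard_inflated (n : ℕ) :
    (A (n + 2)).ncard * 2 = 2 ^ Nat.fib (2 * n + 1) ∧
      (B (n + 2)).ncard = 2 ^ (Nat.fib (2 * n) + 1) := by
  induction n with
  | zero =>
    have hA : (A 1).ncard = 1 := Set.ncard_singleton _
    have hB : (B 1).ncard = 1 := Set.ncard_singleton _
    simp [ncard_A_succ_succ, ncard_B_succ_succ, hA, hB]
  | succ n ih =>
    obtain ⟨hA, hB⟩ := ih
    have h1 : Nat.fib (2 * (n + 1)) = Nat.fib (2 * n) + Nat.fib (2 * n + 1) := Nat.fib_add_two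
    have h2 : Nat.fib (2 * (n + 1) + 1) = Nat.fib (2 * n + 1) + Nat.fib (2 * (n + 1)) :=
      Nat.fib_add_two
    rw [ncard_A_succ_succ, ncard_B_succ_succ (n + 1), hB, h2, h1]
    constructor
    · calc _ = 2 ^ Nat.fib (2 * n) * ((A (n + 2)).ncard * 2) * ((A (n + 2)).ncard * 2) := by ring
        _ = _ := by rw [hA]; ring
    · calc _ = 2 ^ (Nat.fib (2 * n) + 1) * ((A (n + 2)).ncard * 2) := by ring
        _ = _ := by rw [hA]; ring

theorem log_ncard_A (n : ℕ) :
    Real.log (A (n + 2)).ncard = (Nat.fib (2 * n + 1) - 1) * Real.log 2 := by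
  have h : ((A (n + 2)).ncard : ℝ) * 2 = 2 ^ Nat.fib (2 * n + 1) := by
    exact_mod_cast (ncard_inflated n).1
  rw [eq_div_of_mul_eq two_ne_zero h, Real.log_div (by positivity) two_ne_zero, Real.log_pow]
  ring

theorem log_ncard_B (n : ℕ) :
    Real.log (B (n + 2)).ncard = (Nat.fib (2 * n) + 1) * Real.log 2 := by
  rw [(ncard_inflated n).2]
  push_cast
  rw [Real.log_pow]
  push_cast
  ring

/-! ### Fibonacci asymptotics and the growth rate of inflated words. -/

theorem tendsto_fib_atTop : Filter.Tendsto (fun n => (Nat.fib n : ℝ)) Filter.atTop Filter.atTop :=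
  tendsto_natCast_atTop_atTop.comp (Filter.tendsto_atTop_mono' _
    (Filter.eventually_atTop.2 ⟨5, fun _ hn => Nat.le_fib_self hn⟩) Filter.tendsto_id)

theorem ratio_eq_of_ne_zero {p q s : ℝ} (hp : p ≠ 0) (hs : s ≠ 0) (n k : ℕ) :
    (1 - (q / p) ^ n) / (p ^ k * (1 - (q / p) ^ (n + k))) =
      (p ^ n - q ^ n) / s / ((p ^ (n + k) - q ^ (n + k)) / s) := by
  have e : ∀ m, p ^ m - q ^ m = p ^ m * (1 - (q / p) ^ m) := fun m => by
    rw [mul_sub, mul_one, div_pow, mul_div_cancel₀ _ (pow_ne_zero _ hp)]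
  rw [div_div_div_cancel_right₀ hs, e n, e (n + k), pow_add p n k, mul_assoc,
    mul_div_mul_left _ _ (pow_ne_zero _ hp)]

/-- By Binet's formula, with the powers of the golden ratio factored out; the conjugate contributes
a geometrically vanishing error. -/
theorem tendsto_fib_ratio (k : ℕ) :
    Filter.Tendsto (fun n => (Nat.fib n : ℝ) / Nat.fib (n + k)) Filter.atTop
      (nhds (1 / Real.goldenRatio ^ k)) := by
  have hφ := Real.goldenRatio_pos
  have hq : |Real.goldenConj / Real.goldenRatio| < 1 := by
    rw [abs_div, abs_of_pos hφ, div_lt_one hφ, abs_of_neg Real.goldenConj_neg]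
    have := Real.neg_one_lt_goldenConj
    have := Real.one_lt_goldenRatio
    linarith
  have h0 := tendsto_pow_atTop_nhds_zero_of_abs_lt_one hq
  have h1 : Filter.Tendsto (fun n => (1 - (Real.goldenConj / Real.goldenRatio) ^ n) /
      (Real.goldenRatio ^ k * (1 - (Real.goldenConj / Real.goldenRatio) ^ (n + k))))
      Filter.atTop (nhds ((1 - 0) / (Real.goldenRatio ^ k * (1 - 0)))) :=
    (tendsto_const_nhds.sub h0).div (tendsto_const_nhds.mul
      (tendsto_const_nhds.sub (h0.comp (Filter.tendsto_add_atTop_nat k)))) (by positivity)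
  simp only [sub_zero, mul_one] at h1
  refine h1.congr fun n => ?_
  rw [Real.coe_fib_eq, Real.coe_fib_eq]
  exact ratio_eq_of_ne_zero hφ.ne' (by positivity) n k

theorem tendsto_log_ncard_A : Filter.Tendsto
    (fun n : ℕ => Real.log ((A n).ncard : ℝ) / (Nat.fib (2 * n) : ℝ))
    Filter.atTop (nhds (1 / Real.goldenRatio ^ 3 * Real.log 2)) := by
  rw [← Filter.tendsto_add_atTop_iff_nat 2]
  have hs : Filter.Tendsto (fun n : ℕ => 2 * n + 1) Filter.atTop Filter.atTop :=
    Filter.tendsto_atTop_mono (fun n => by simp; omega) Filter.tendsto_id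
  have h := (((tendsto_fib_ratio 3).comp hs).sub (tendsto_fib_atTop.inv_tendsto_atTop.comp
    ((Filter.tendsto_add_atTop_nat 3).comp hs))).mul_const (Real.log 2)
  rw [sub_zero] at h
  refine h.congr fun n => ?_
  rw [log_ncard_A]
  simp only [Function.comp, Pi.inv_apply, show 2 * (n + 2) = 2 * n + 1 + 3 by ring]
  ring

theorem tendsto_log_ncard_B : Filter.Tendsto
    (fun n : ℕ => Real.log ((B n).ncard : ℝ) / (Nat.fib (2 * n - 1) : ℝ))
    Filter.atTop (nhds (1 / Real.goldenRatio ^ 3 * Real.log 2)) := by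
  rw [← Filter.tendsto_add_atTop_iff_nat 2]
  have hs : Filter.Tendsto (fun n : ℕ => 2 * n) Filter.atTop Filter.atTop :=
    Filter.tendsto_atTop_mono (fun n => by simp; omega) Filter.tendsto_id
  have h := (((tendsto_fib_ratio 3).comp hs).add (tendsto_fib_atTop.inv_tendsto_atTop.comp
    ((Filter.tendsto_add_atTop_nat 3).comp hs))).mul_const (Real.log 2)
  rw [add_zero] at h
  refine h.congr fun n => ?_
  rw [log_ncard_B]
  simp only [Function.comp, Pi.inv_apply, show 2 * (n + 2) - 1 = 2 * n + 3 by omega]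
  ring

/-! ### The limit sets, their sub-words and the subshift. -/

/-- Each word of $A_{n+1}$ begins with a word of $B_n$, which is eventually longer than any given
prefix. -/
theorem limA_eq_limB : limA = limB := by
  ext w
  refine forall_congr' fun k => ⟨fun h => ?_, fun h => ?_⟩
  · obtain ⟨N, hN⟩ := Filter.eventually_atTop.1 h
    obtain ⟨v, hv, hp⟩ := hN (N + k + 2) (by omega)
    rw [A_succ_succ] at hv
    obtain ⟨y, hy, z, hz, z', hz', rfl⟩ := hv
    have hl := (inflated_aux _).2.2.2 y hy
    have hpy : List.ofFn (fun j : Fin k => w j) <+: y := by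
      refine List.prefix_of_prefix_length_le hp ?_ (by simp; omega)
      exact (List.prefix_append y z).trans (List.prefix_append (y ++ z) z')
    refine Filter.eventually_atTop.2 ⟨N + k + 1, fun m hm => ?_⟩
    obtain ⟨m, rfl⟩ := Nat.exists_eq_add_of_le' (show 1 ≤ m by omega)
    exact prefix_B_mono (n := N + k) (by omega) ⟨y, hy, hpy⟩
  · obtain ⟨N, hN⟩ := Filter.eventually_atTop.1 h
    refine Filter.eventually_atTop.2 ⟨N + 2, fun m hm => ?_⟩
    obtain ⟨m, rfl⟩ := Nat.exists_eq_add_of_le' (show 2 ≤ m by omega)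
    obtain ⟨v, hv, hp⟩ := hN (m + 1) (by omega)
    obtain ⟨x, hx⟩ := (inflated_aux m).1
    exact ⟨_, append_mem_A hv hx hx, hp.trans
      ((List.prefix_append v x).trans (List.prefix_append (v ++ x) x))⟩

theorem ofFn_prefix_ofFn (w : ℕ → Letter) {k l : ℕ} (h : k ≤ l) :
    List.ofFn (fun j : Fin k => w j) <+: List.ofFn (fun j : Fin l => w j) := by
  obtain ⟨d, rfl⟩ := Nat.exists_eq_add_of_le h
  rw [List.ofFn_add]
  exact List.prefix_append _ _

theorem ofFn_infix_ofFn (z : ℤ → Letter) (s : ℤ) (c n d : ℕ) :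
    List.ofFn (fun t : Fin n => z (s + c + t)) <:+:
      List.ofFn (fun t : Fin (c + n + d) => z (s + t)) := by
  refine ⟨List.ofFn (fun t : Fin c => z (s + t)),
    List.ofFn (fun t : Fin d => z (s + (c + n) + t)), ?_⟩
  rw [List.ofFn_add, List.ofFn_add]
  simp [add_assoc]

/-- An increasing sequence of words of unbounded length has an infinite limit word. -/
theorem exists_limit_word {R : ℕ → List Letter} (hR : ∀ k, R k <+: R (k + 1))
    (hl : ∀ k, k ≤ (R k).length) :
    ∃ w : ℕ → Letter, ∀ k, R k = List.ofFn (fun j : Fin (R k).length => w j) := by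
  have mono : ∀ {k l}, k ≤ l → R k <+: R l := fun {k l} h => by
    induction l, h using Nat.le_induction with
    | base => exact List.prefix_rfl
    | succ l _ ih => exact ih.trans (hR l)
  refine ⟨fun i => (R (i + 1))[i]'(hl (i + 1)), fun k => List.ext_getElem (by simp) ?_⟩
  intro i h1 h2
  simp only [List.getElem_ofFn]
  rcases le_total k (i + 1) with h | h
  · exact (mono h).getElem h1
  · exact ((mono h).getElem (hl (i + 1))).symm

/-- The sub-words of the infinite words are the sub-words of the inflated words. -/
theorem mem_F_limB {x : List Letter} {m : ℕ} :
    x ∈ F limB m ↔ x.length = m ∧ ∃ k, ∃ v ∈ B (k + 1), x <:+: v := by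
  constructor
  · rintro ⟨w, hw, i, rfl⟩
    refine ⟨by simp, ?_⟩
    obtain ⟨N, hN⟩ := Filter.eventually_atTop.1 (hw (i + m))
    obtain ⟨v, hv, hp⟩ := hN (N + 1) (by omega)
    refine ⟨N, v, hv, List.IsInfix.trans ?_ hp.isInfix⟩
    rw [List.ofFn_add]
    exact (List.suffix_append _ _).isInfix
  · rintro ⟨rfl, k, v, hv, p, s, rfl⟩
    choose u hu using fun n => (inflated_aux n).1
    -- Appending words of $A$ on the right stays inside the sets $B$, one generation higher each
    -- time.
    let R : ℕ → List Letter := fun j => Nat.rec (p ++ x ++ s) (fun j y => y ++ u (k + j)) j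
    have hR : ∀ j, R j ∈ B (k + j + 1) := fun j => by
      induction j with
      | zero => exact hv
      | succ j ih => exact append_mem_B_right (hu (k + j)) ih
    have hl : ∀ j, j ≤ (R j).length := fun j => by
      have := (inflated_aux (k + j)).2.2.2 _ (hR j)
      omega
    obtain ⟨w, hw⟩ := exists_limit_word (R := R) (fun j => List.prefix_append _ _) hl
    refine ⟨w, fun K => limB_wellDefined _ (Filter.frequently_atTop.2 fun N => ?_), p.length, ?_⟩
    · refine ⟨k + (N + K) + 1, by omega, R (N + K), hR _, ?_⟩
      rw [hw (N + K)]
      exact ofFn_prefix_ofFn w (by have := hl (N + K); omega)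
    · have h0 : p ++ x ++ s = List.ofFn (fun j : Fin (p ++ x ++ s).length => w j) := hw 0
      refine List.ext_getElem (by simp) fun i h1 h2 => ?_
      have h3 : p.length + i < (p ++ x ++ s).length := by simp; omega
      have h4 : (p ++ x ++ s)[p.length + i] = w (p.length + i) := by
        rw [List.getElem_of_eq h0 h3]
        simp
      simpa [List.getElem_append_left, h1] using h4

/-- The bi-infinite word with the given right and (reversed) left half. -/
def glue (l r : ℕ → Letter) : ℤ → Letter
  | Int.ofNat n => r n
  | Int.negSucc n => l n

theorem reverse_append_eq_ofFn_glue (l r : ℕ → Letter) (m n : ℕ) :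
    (List.ofFn (fun j : Fin m => l j)).reverse ++ List.ofFn (fun j : Fin n => r j) =
      List.ofFn (fun t : Fin (m + n) => glue l r (-m + t)) := by
  refine List.ext_getElem (by simp) fun i h1 h2 => ?_
  simp only [List.getElem_append, List.getElem_ofFn, List.getElem_reverse, List.length_reverse,
    List.length_ofFn]
  split_ifs with h
  · rw [show (-m + i : ℤ) = Int.negSucc (m - 1 - i) by omega]
    rfl
  · rw [show (-m + i : ℤ) = Int.ofNat (i - m) by simp; omega]
    rfl

/-- Every sub-word of length `n` occurs in the subshift at the origin. -/
theorem exists_mem_subshift {x : List Letter} {n : ℕ} (hx : x ∈ F limB n) :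
    ∃ z ∈ subshift limB, x = List.ofFn (fun j : Fin n => z j) := by
  obtain ⟨rfl, k, v, hv, p, s, rfl⟩ := mem_F_limB.1 hx
  choose u hu using fun n => (inflated_aux n).1
  -- Each step passes two generations, attaching a word of $A$ first on the left and then on the
  -- right, so both halves grow. The left half is stored reversed so that it grows by prefixes.
  let R : ℕ → List Letter := fun j => Nat.rec (x ++ s) (fun j y => y ++ u (k + 2 * j + 1)) j
  let L : ℕ → List Letter := fun j => Nat.rec p.reverse (fun j y => y ++ (u (k + 2 * j)).reverse) j
  have hV : ∀ j, (L j).reverse ++ R j ∈ B (k + 2 * j + 1) := fun j => by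
    induction j with
    | zero => simpa [L, R] using hv
    | succ j ih =>
      have h := append_mem_B_right (hu (k + 2 * j + 1)) (append_mem_B_left (hu (k + 2 * j)) ih)
      rw [show k + 2 * (j + 1) + 1 = k + 2 * j + 1 + 2 by ring]
      simpa [L, R, List.append_assoc] using h
  have hu1 : ∀ j, 1 ≤ (u j).length := fun j => by
    have := (inflated_aux j).2.2.1 _ (hu j)
    omega
  have hRl : ∀ j, j ≤ (R j).length := fun j => by
    induction j with
    | zero => simp
    | succ j ih =>
      have := hu1 (k + 2 * j + 1)
      simp only [R, List.length_append] at ih ⊢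
      omega
  have hLl : ∀ j, j ≤ (L j).length := fun j => by
    induction j with
    | zero => simp
    | succ j ih =>
      have := hu1 (k + 2 * j)
      simp only [L, List.length_append, List.length_reverse] at ih ⊢
      omega
  obtain ⟨r, hr⟩ := exists_limit_word (R := R) (fun j => List.prefix_append _ _) hRl
  obtain ⟨l, hl⟩ := exists_limit_word (R := L) (fun j => List.prefix_append _ _) hLl
  refine ⟨glue l r, fun i n => mem_F_limB.2 ⟨by simp, ?_⟩, ?_⟩
  · let j := i.natAbs + n
    refine ⟨_, _, hV j, ?_⟩
    have h1 : i.natAbs + n ≤ (L j).length := hLl j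
    have h2 : i.natAbs + n ≤ (R j).length := hRl j
    rw [hl j, hr j, reverse_append_eq_ofFn_glue]
    generalize (L j).length = a at *
    generalize (R j).length = b at *
    obtain ⟨c, hc⟩ := Int.eq_ofNat_of_zero_le (show 0 ≤ i + a by omega)
    obtain ⟨d, hd⟩ := Nat.exists_eq_add_of_le (show c + n ≤ a + b by omega)
    obtain rfl : i = -a + c := by omega
    rw [hd]
    exact ofFn_infix_ofFn _ _ _ _ _
  · have h0 : x ++ s = List.ofFn (fun j : Fin (x ++ s).length => r j) := hr 0
    refine List.ext_getElem (by simp) fun i h1 h2 => ?_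
    have h3 : i < (x ++ s).length := by simp; omega
    have h4 : (x ++ s)[i] = r i := by
      rw [List.getElem_of_eq h0 h3]
      simp
    rw [List.getElem_append_left h1] at h4
    rw [h4]
    simp [glue]

/-! ### Subadditivity and the lower bound. -/

theorem finite_F (S : Set (ℕ → Letter)) (n : ℕ) : (F S n).Finite :=
  finite_of_length_eq (k := n) (by rintro _ ⟨w, -, i, rfl⟩; simp)

theorem F_limB_nonempty (n : ℕ) : (F limB n).Nonempty := by
  obtain ⟨v, hv⟩ := (inflated_aux n).2.1
  have hl := (inflated_aux n).2.2.2 v hv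
  exact ⟨v.take n, mem_F_limB.2 ⟨by simp; omega, n, v, hv, (List.take_prefix n v).isInfix⟩⟩

theorem ncard_F_limB_pos (n : ℕ) : 0 < (F limB n).ncard :=
  (Set.ncard_pos (finite_F limB n)).2 (F_limB_nonempty n)

theorem ncard_F_add_le (S : Set (ℕ → Letter)) (m n : ℕ) :
    (F S (m + n)).ncard ≤ (F S m).ncard * (F S n).ncard := by
  rw [← Set.ncard_prod]
  refine (Set.ncard_le_ncard ?_ (((finite_F S m).prod (finite_F S n)).image
    fun p => p.1 ++ p.2)).trans (Set.ncard_image_le ((finite_F S m).prod (finite_F S n)))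
  rintro _ ⟨w, hw, i, rfl⟩
  refine ⟨(List.ofFn (fun j : Fin m => w (i + j)), List.ofFn (fun j : Fin n => w (i + m + j))),
    ⟨⟨w, hw, i, rfl⟩, ⟨w, hw, i + m, rfl⟩⟩, ?_⟩
  rw [List.ofFn_add]
  simp [add_assoc]

theorem subadditive_log_ncard_F : Subadditive fun n => Real.log (F limB n).ncard := by
  intro m n
  have h0 := fun n => Nat.cast_pos (α := ℝ).2 (ncard_F_limB_pos n)
  dsimp only
  rw [← Real.log_mul (h0 m).ne' (h0 n).ne']
  exact Real.log_le_log (h0 _) (by exact_mod_cast ncard_F_add_le limB m n)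

theorem tendsto_log_ncard_F_lim : Filter.Tendsto
    (fun n : ℕ => Real.log (F limB n).ncard / n) Filter.atTop
    (nhds subadditive_log_ncard_F.lim) := by
  refine subadditive_log_ncard_F.tendsto_lim ⟨0, ?_⟩
  rintro _ ⟨n, rfl⟩
  exact div_nonneg (Real.log_natCast_nonneg _) n.cast_nonneg

theorem tendsto_natFib_two_mul : Filter.Tendsto (fun n => Nat.fib (2 * n)) Filter.atTop
    Filter.atTop := by
  have h := tendsto_natCast_atTop_iff.1 tendsto_fib_atTop
  exact h.comp (Filter.tendsto_atTop_mono (fun n => by simp; omega) Filter.tendsto_id)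

theorem tendsto_natFib_two_mul_sub_one : Filter.Tendsto (fun n => Nat.fib (2 * n - 1)) Filter.atTop
    Filter.atTop := by
  have h := tendsto_natCast_atTop_iff.1 tendsto_fib_atTop
  refine h.comp (Filter.tendsto_atTop_mono' _ (Filter.eventually_atTop.2 ⟨1, fun n hn => ?_⟩)
    Filter.tendsto_id)
  simp only [id]
  omega

theorem A_subset_F (n : ℕ) : A (n + 1) ⊆ F limB (Nat.fib (2 * (n + 1))) := by
  intro x hx
  obtain ⟨y, hy⟩ := (inflated_aux n).2.1
  exact mem_F_limB.2 ⟨(length_inflated n).1 x hx, n + 1, _, append_mem_B_left hx hy,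
    (List.prefix_append x y).isInfix⟩

theorem le_lim_log_ncard_F :
    1 / Real.goldenRatio ^ 3 * Real.log 2 ≤ subadditive_log_ncard_F.lim := by
  refine le_of_tendsto_of_tendsto tendsto_log_ncard_A
    (tendsto_log_ncard_F_lim.comp tendsto_natFib_two_mul)
    (Filter.eventually_atTop.2 ⟨1, fun n hn => ?_⟩)
  obtain ⟨n, rfl⟩ := Nat.exists_eq_add_of_le' hn
  refine div_le_div_of_nonneg_right (Real.log_le_log ?_ ?_) (Nat.cast_nonneg _)
  · exact_mod_cast (Set.ncard_pos (finite_A n)).2 (inflated_aux n).1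
  · exact_mod_cast Set.ncard_le_ncard (A_subset_F n) (finite_F _ _)

/-! ### The upper bound by counting concatenations. -/

/-- The number of concatenations of length `M` of words from two sets of words of constant lengths
`p` and `q` grows at most with the rate given by the characteristic inequality. -/
theorem ncard_kstar_le {S T : Language Letter} {p q : ℕ} (hp : 0 < p) (hq : 0 < q)
    (hS : ∀ v ∈ S, v.length = p) (hT : ∀ v ∈ T, v.length = q) {θ : ℝ}
    (h : (Set.ncard (S : Set (List Letter)) : ℝ) * Real.exp (-(θ * p)) +
      (Set.ncard (T : Set (List Letter)) : ℝ) * Real.exp (-(θ * q)) ≤ 1) (M : ℕ) :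
    ({x | x ∈ (S + T)∗ ∧ x.length = M}.ncard : ℝ) ≤ Real.exp (θ * M) := by
  induction M using Nat.strong_induction_on with
  | _ M ih =>
  have fin : ∀ M, {x | x ∈ (S + T)∗ ∧ x.length = M}.Finite := fun M =>
    finite_of_length_eq (fun v hv => hv.2)
  -- Stripping a leading block of length $k$ leaves a concatenation of length $M-k$. The
  -- coefficients obtained for `S` and `T` sum to at most 1 by `h`.
  have part : ∀ (U : Set (List Letter)) (k : ℕ), 0 < k → (∀ v ∈ U, v.length = k) →
      ({x | ∃ t ∈ U, ∃ y ∈ (S + T)∗, x = t ++ y ∧ x.length = M}.ncard : ℝ) ≤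
        U.ncard * Real.exp (-(θ * k)) * Real.exp (θ * M) := by
    intro U k hk hU
    rcases le_or_gt k M with hkM | hkM
    · have h1 : {x | ∃ t ∈ U, ∃ y ∈ (S + T)∗, x = t ++ y ∧ x.length = M} ⊆
          Set.image2 (· ++ ·) U {x | x ∈ (S + T)∗ ∧ x.length = M - k} := by
        rintro _ ⟨t, ht, y, hy, rfl, hM⟩
        refine ⟨t, ht, y, ⟨hy, ?_⟩, rfl⟩
        rw [List.length_append, hU t ht] at hM
        omega
      have h2 := Set.ncard_le_ncard h1 ((finite_of_length_eq hU).image2 _ (fin _))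
      rw [ncard_image2_append hU] at h2
      calc _ ≤ (U.ncard : ℝ) * ({x | x ∈ (S + T)∗ ∧ x.length = M - k}.ncard : ℝ) := by
            exact_mod_cast h2
        _ ≤ U.ncard * Real.exp (θ * (M - k : ℕ)) := by
            gcongr
            exact ih _ (by omega)
        _ = _ := by
            rw [mul_assoc, ← Real.exp_add, Nat.cast_sub hkM]
            ring_nf
    · have h1 : {x | ∃ t ∈ U, ∃ y ∈ (S + T)∗, x = t ++ y ∧ x.length = M} = ∅ := by
        refine Set.eq_empty_of_forall_notMem ?_
        rintro _ ⟨t, ht, y, hy, rfl, hM⟩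
        rw [List.length_append, hU t ht] at hM
        omega
      rw [h1]
      simp only [Set.ncard_empty, Nat.cast_zero]
      positivity
  rcases Nat.eq_zero_or_pos M with rfl | hM
  · have h1 : {x | x ∈ (S + T)∗ ∧ x.length = 0} ⊆ {[]} := fun x hx =>
      List.length_eq_zero_iff.1 hx.2
    have h2 := Set.ncard_le_ncard h1 (Set.finite_singleton _)
    rw [Set.ncard_singleton] at h2
    simpa using h2
  · have hsub : {x | x ∈ (S + T)∗ ∧ x.length = M} ⊆
        {x | ∃ t ∈ S, ∃ y ∈ (S + T)∗, x = t ++ y ∧ x.length = M} ∪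
        {x | ∃ t ∈ T, ∃ y ∈ (S + T)∗, x = t ++ y ∧ x.length = M} := by
      rintro x ⟨hx, hxM⟩
      rw [← Language.one_add_self_mul_kstar_eq_kstar] at hx
      rcases hx with hx | ⟨t, ht, y, hy, rfl⟩
      · obtain rfl : x = [] := hx
        simp at hxM
        omega
      · rcases ht with ht | ht
        · exact Or.inl ⟨t, ht, y, hy, rfl, hxM⟩
        · exact Or.inr ⟨t, ht, y, hy, rfl, hxM⟩
    have h1 := (Set.ncard_le_ncard hsub (finite_of_length_eq (k := M) (by
      rintro _ (⟨_, _, _, _, rfl, h⟩ | ⟨_, _, _, _, rfl, h⟩) <;> exact h))).trans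
      (Set.ncard_union_le _ _)
    have h2 := part S p hp hS
    have h3 := part T q hq hT
    have h4 := (Nat.cast_le (α := ℝ)).2 h1
    push_cast at h4
    refine (h4.trans (add_le_add h2 h3)).trans ?_
    rw [← add_mul]
    exact mul_le_of_le_one_left (Real.exp_pos _).le h

/-- Only the block in which `x` ends needs completing. -/
theorem exists_append_mem_kstar {T : Language Letter} {D : ℕ} (hT : ∀ t ∈ T, t.length ≤ D)
    {x : List Letter} {l : List (List Letter)} (hl : ∀ t ∈ l, t ∈ T) (hx : x <+: l.flatten) :
    ∃ s, s.length ≤ D ∧ x ++ s ∈ T∗ := by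
  induction l generalizing x with
  | nil =>
    obtain rfl : x = [] := by simpa using hx
    exact ⟨[], by simp, Language.nil_mem_kstar T⟩
  | cons t l ih =>
    rw [List.flatten_cons] at hx
    have ht : t ∈ T := hl t (by simp)
    rcases le_total x.length t.length with h | h
    · obtain ⟨s, rfl⟩ := List.prefix_of_prefix_length_le hx (List.prefix_append t _) h
      refine ⟨s, ?_, Language.mem_kstar.2 ⟨[x ++ s], by simp, by simpa using ht⟩⟩
      have := hT _ ht
      simp only [List.length_append] at this
      omega
    · obtain ⟨y, rfl⟩ := List.prefix_of_prefix_length_le (List.prefix_append t _) hx h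
      obtain ⟨s, hs, hys⟩ := ih (fun t ht => hl t (by simp [ht]))
        ((List.prefix_append_right_inj t).1 hx)
      refine ⟨s, hs, ?_⟩
      rw [← Language.one_add_self_mul_kstar_eq_kstar]
      exact Or.inr ⟨t, ht, y ++ s, hys, by simp⟩

/-- A sub-word of a concatenation of words of length at most `D` extends to a concatenation by at
most `D` letters on either side. -/
theorem exists_append_append_mem_kstar {T : Language Letter} {D : ℕ} (hT : ∀ t ∈ T, t.length ≤ D)
    {x v : List Letter} (hv : v ∈ T∗) (hx : x <:+: v) :
    ∃ p s, p.length ≤ D ∧ s.length ≤ D ∧ p ++ x ++ s ∈ T∗ := by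
  obtain ⟨l, rfl, hl⟩ := Language.mem_kstar.1 hv
  obtain ⟨p, s, h⟩ := hx
  replace h : p ++ x <+: l.flatten := ⟨s, h⟩
  clear hv s
  induction l generalizing p with
  | nil =>
    have : p = [] ∧ x = [] := by simpa using h
    obtain ⟨rfl, rfl⟩ := this
    exact ⟨[], [], by simp, by simp, Language.nil_mem_kstar T⟩
  | cons t l ih =>
    rcases le_total p.length t.length with hp | hp
    · obtain ⟨s, hs, hxs⟩ := exists_append_mem_kstar hT hl h
      exact ⟨p, s, hp.trans (hT _ (hl t (by simp))), hs, hxs⟩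
    · rw [List.flatten_cons] at h
      obtain ⟨y, rfl⟩ := List.prefix_of_prefix_length_le (List.prefix_append t _)
        ((List.prefix_append p x).trans h) hp
      rw [List.append_assoc] at h
      exact ih (fun t ht => hl t (by simp [ht])) y ((List.prefix_append_right_inj t).1 h)

theorem append_mem_kstar {T : Language Letter} {x y : List Letter} (hx : x ∈ T∗) (hy : y ∈ T∗) :
    x ++ y ∈ T∗ := by
  rw [← kstar_mul_kstar T]
  exact ⟨x, hx, y, hy, rfl⟩

/-- The set of inflated words in generation `k + 1`, starting from either letter. -/
def tiles (k : ℕ) : Language Letter := (inflated (k + 1)).1 + (inflated (k + 1)).2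

theorem inflated_subset_kstar {k n : ℕ} (h : k ≤ n) :
    (∀ x ∈ A (n + 1), x ∈ (tiles k)∗) ∧
      (∀ x ∈ B (n + 1), x ∈ (tiles k)∗) := by
  induction n, h using Nat.le_induction with
  | base =>
    refine ⟨fun x hx => le_kstar (a := tiles k) (Or.inl hx),
      fun x hx => le_kstar (a := tiles k) (Or.inr hx)⟩
  | succ n _ ih =>
    refine ⟨fun x hx => ?_, ?_⟩
    · rw [A_succ_succ] at hx
      obtain ⟨b, hb, a, ha, a', ha', rfl⟩ := hx
      exact append_mem_kstar (append_mem_kstar (ih.2 b hb) (ih.1 a ha)) (ih.1 a' ha')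
    · rintro x (⟨a, ha, b, hb, rfl⟩ | ⟨b, hb, a, ha, rfl⟩)
      · exact append_mem_kstar (ih.1 a ha) (ih.2 b hb)
      · exact append_mem_kstar (ih.2 b hb) (ih.1 a ha)

/-- The constant sums over all pairs of overhang lengths up to `D`; a sub-word is recovered from the
extended concatenation and its overhangs. -/
theorem ncard_F_le (k : ℕ) {θ : ℝ}
    (h : ((A (k + 1)).ncard : ℝ) * Real.exp (-(θ * Nat.fib (2 * k + 2))) +
      ((B (k + 1)).ncard : ℝ) * Real.exp (-(θ * Nat.fib (2 * k + 1))) ≤ 1) :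
    ∃ K : ℝ, 0 < K ∧ ∀ m : ℕ, ((F limB m).ncard : ℝ) ≤ K * Real.exp (θ * m) := by
  set D := Nat.fib (2 * k + 2) with hD
  have hcount : ∀ M : ℕ, ({x | x ∈ (tiles k)∗ ∧ x.length = M}.ncard : ℝ) ≤ Real.exp (θ * M) :=
    ncard_kstar_le (S := (inflated (k + 1)).1) (T := (inflated (k + 1)).2)
      (Nat.fib_pos.2 (by omega)) (Nat.fib_pos.2 (by omega))
      (length_inflated k).1 (length_inflated k).2 h
  have hlen : ∀ t ∈ tiles k, t.length ≤ D := by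
    rintro t (ht | ht)
    · exact ((length_inflated k).1 t ht).le
    · exact ((length_inflated k).2 t ht).le.trans (Nat.fib_mono (by omega))
  let I := Finset.range (D + 1) ×ˢ Finset.range (D + 1)
  refine ⟨∑ i ∈ I, Real.exp (θ * (i.1 + i.2)), ?_, fun m => ?_⟩
  · exact Finset.sum_pos (fun i _ => Real.exp_pos _) ⟨(0, 0), by simp [I]⟩
  let G : ℕ × ℕ → Set (List Letter) := fun i =>
    (fun y => (y.drop i.1).take m) '' {x | x ∈ (tiles k)∗ ∧ x.length = m + i.1 + i.2}
  have finG : ∀ M, {x | x ∈ (tiles k)∗ ∧ x.length = M}.Finite := fun M =>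
    finite_of_length_eq (fun v hv => hv.2)
  have hsub : F limB m ⊆ ⋃ i ∈ I, G i := by
    intro x hx
    obtain ⟨rfl, n, v, hv, hxv⟩ := mem_F_limB.1 hx
    -- The containing word may come from too early a generation to be tiled, so it is first
    -- extended.
    obtain ⟨v', hv', hvv'⟩ := prefix_B_mono (Nat.le_add_right n k) ⟨v, hv, List.prefix_rfl⟩
    obtain ⟨p, s, hp, hs, hpxs⟩ := exists_append_append_mem_kstar hlen
      ((inflated_subset_kstar (Nat.le_add_left k n)).2 v' hv') (hxv.trans hvv'.isInfix)
    refine Set.mem_biUnion (x := (p.length, s.length)) ?_ ⟨p ++ x ++ s, ⟨hpxs, ?_⟩, ?_⟩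
    · simp [I]; omega
    · simp; omega
    · simp
  have h1 := Set.ncard_le_ncard hsub (Set.Finite.biUnion I.finite_toSet
    fun i _ => (finG _).image _)
  have h2 := h1.trans (Finset.set_ncard_biUnion_le I G)
  calc ((F limB m).ncard : ℝ) ≤ ∑ i ∈ I, ((G i).ncard : ℝ) := by exact_mod_cast h2
    _ ≤ ∑ i ∈ I, Real.exp (θ * (i.1 + i.2)) * Real.exp (θ * m) := by
      refine Finset.sum_le_sum fun i _ => ?_
      calc ((G i).ncard : ℝ) ≤ _ := Nat.cast_le.2 (Set.ncard_image_le (finG _))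
        _ ≤ _ := hcount _
        _ = _ := by
          rw [← Real.exp_add]
          push_cast
          ring_nf
    _ = _ := by rw [Finset.sum_mul]

theorem eventually_mul_exp_le_half {c d : ℕ → ℕ} {h θ : ℝ} (hθ : h < θ)
    (hd : Filter.Tendsto d Filter.atTop Filter.atTop)
    (hc : Filter.Tendsto (fun n => Real.log (c n) / d n) Filter.atTop (nhds h)) :
    ∀ᶠ n in Filter.atTop, (c n : ℝ) * Real.exp (-(θ * d n)) ≤ 1 / 2 := by
  have hd' : Filter.Tendsto (fun n => (θ - (h + θ) / 2) * (d n : ℝ)) Filter.atTop Filter.atTop :=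
    (tendsto_natCast_atTop_atTop.comp hd).const_mul_atTop (by linarith)
  -- The midpoint leaves a gap: eventually $\log c_n-\theta d_n\le-\frac{\theta-h}{2}d_n\le-\log2$.
  filter_upwards [hc.eventually_lt_const (show h < (h + θ) / 2 by linarith),
    hd'.eventually_ge_atTop (Real.log 2), hd.eventually_gt_atTop 0] with n h1 h2 h3
  rcases Nat.eq_zero_or_pos (c n) with h0 | h0
  · simp [h0]
  have h3' : (0 : ℝ) < d n := by exact_mod_cast h3
  rw [div_lt_iff₀ h3'] at h1
  calc (c n : ℝ) * Real.exp (-(θ * d n))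
      = Real.exp (Real.log (c n) - θ * d n) := by
        rw [sub_eq_add_neg, Real.exp_add, Real.exp_log (by exact_mod_cast h0)]
    _ ≤ Real.exp (-Real.log 2) := Real.exp_le_exp.2 (by linarith)
    _ = 1 / 2 := by rw [Real.exp_neg, Real.exp_log two_pos, one_div]

theorem lim_log_ncard_F_le :
    subadditive_log_ncard_F.lim ≤ 1 / Real.goldenRatio ^ 3 * Real.log 2 := by
  refine le_of_forall_gt_imp_ge_of_dense fun θ hθ => ?_
  obtain ⟨n, ⟨h1, h2⟩, hn⟩ := ((eventually_mul_exp_le_half hθ tendsto_natFib_two_mul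
    tendsto_log_ncard_A).and (eventually_mul_exp_le_half hθ tendsto_natFib_two_mul_sub_one
    tendsto_log_ncard_B)).and (Filter.eventually_ge_atTop 1) |>.exists
  obtain ⟨k, rfl⟩ := Nat.exists_eq_add_of_le' hn
  obtain ⟨K, hK, hF⟩ := ncard_F_le k ((add_le_add h1 h2).trans (by norm_num))
  have hlim : Filter.Tendsto (fun m : ℕ => Real.log K / m + θ) Filter.atTop (nhds (0 + θ)) :=
    (tendsto_const_div_atTop_nhds_zero_nat _).add_const θ
  rw [zero_add] at hlim
  refine le_of_tendsto_of_tendsto tendsto_log_ncard_F_lim hlim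
    (Filter.eventually_atTop.2 ⟨1, fun m hm => ?_⟩)
  have hm' : (0 : ℝ) < m := by exact_mod_cast hm
  have h3 := Real.log_le_log (Nat.cast_pos.2 (ncard_F_limB_pos m)) (hF m)
  rw [Real.log_mul hK.ne' (Real.exp_pos _).ne', Real.log_exp] at h3
  rw [div_le_iff₀ hm', add_mul, div_mul_cancel₀ _ hm'.ne']
  exact h3

theorem tendsto_log_ncard_F : Filter.Tendsto
    (fun n : ℕ => Real.log (F limB n).ncard / n) Filter.atTop
    (nhds (1 / Real.goldenRatio ^ 3 * Real.log 2)) :=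
  le_antisymm lim_log_ncard_F_le le_lim_log_ncard_F ▸ tendsto_log_ncard_F_lim

/-! ### Topological entropy of the subshift. -/

theorem iterate_shift (x : ℤ → Letter) (k : ℕ) (i : ℤ) : shift^[k] x i = x (i + k) := by
  induction k generalizing x with
  | zero => simp
  | succ k ih =>
    rw [Function.iterate_succ_apply, ih]
    simp only [shift]
    push_cast
    ring_nf

/-- The entourage of all pairs of words which agree on the interval `[-r, r]`. -/
def cylinder (r : ℕ) : SetRel (ℤ → Letter) (ℤ → Letter) :=
  {p | ∀ i : ℤ, i.natAbs ≤ r → p.1 i = p.2 i}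

theorem mem_dynEntourage_cylinder {r n : ℕ} {x y : ℤ → Letter} :
    (x, y) ∈ Dynamics.dynEntourage shift (cylinder r) n ↔
      ∀ k < n, ∀ i : ℤ, i.natAbs ≤ r → x (i + k) = y (i + k) := by
  simp only [Dynamics.mem_dynEntourage, cylinder, Set.mem_ofPred_eq, iterate_shift]

theorem uniformity_letter : uniformity Letter = Filter.principal SetRel.id := rfl

theorem cylinder_zero_mem_uniformity : cylinder 0 ∈ uniformity (ℤ → Letter) := by
  rw [Pi.uniformity]
  refine Filter.mem_iInf_of_mem 0 ⟨SetRel.id, ?_, ?_⟩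
  · rw [uniformity_letter]
    exact Filter.mem_principal_self _
  · intro p hp i hi
    obtain rfl : i = 0 := by omega
    exact hp

theorem exists_cylinder_subset {U : SetRel (ℤ → Letter) (ℤ → Letter)}
    (hU : U ∈ uniformity (ℤ → Letter)) : ∃ r, cylinder r ⊆ U := by
  rw [Pi.uniformity, Filter.mem_iInf] at hU
  obtain ⟨I, hI, V, hV, rfl⟩ := hU
  obtain ⟨r, hr⟩ := (hI.image Int.natAbs).bddAbove
  refine ⟨r, fun p hp => Set.mem_iInter.2 fun i => ?_⟩
  obtain ⟨W, hW, hWV⟩ := hV i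
  rw [uniformity_letter, Filter.mem_principal] at hW
  exact hWV (hW (hp i (hr ⟨i, i.2, rfl⟩)))

theorem coverMincard_cylinder_le (S : Set (ℕ → Letter)) (r n : ℕ) :
    Dynamics.coverMincard shift (subshift S) (cylinder r) n ≤ ((F S (n + 2 * r)).ncard : ℕ∞) := by
  classical
  -- In $n$ steps the window $[-r,r]$ sees only coordinates in $[-r,n+r)$, so these letters suffice.
  -- The padding by `a` is harmless: centres need not lie in the subshift.
  let c : List Letter → ℤ → Letter := fun x i => x.getD (i + r).toNat a
  have hs : Dynamics.IsDynCoverOf shift (subshift S) (cylinder r) n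
      ((finite_F S (n + 2 * r)).toFinset.image c : Finset (ℤ → Letter)) := by
    intro y hy
    refine ⟨_, Finset.mem_coe.2 (Finset.mem_image_of_mem c
      ((finite_F S _).mem_toFinset.2 (hy (-r) (n + 2 * r)))), ?_⟩
    rw [mem_dynEntourage_cylinder]
    intro k hk i hi
    obtain ⟨j, hj⟩ := Int.eq_ofNat_of_zero_le (show 0 ≤ i + k + r by omega)
    have hj' : j < n + 2 * r := by omega
    have h : i + k = -r + j := by omega
    simp [c, hj', h]
  refine hs.coverMincard_le_card.trans ?_
  rw [Set.ncard_eq_toFinset_card _ (finite_F S _)]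
  exact_mod_cast Finset.card_image_le

/-- Already radius 0 sees the coordinates $0,\dots,n-1$, so every word realised there must be read
off some centre of the cover. -/
theorem ncard_F_le_coverMincard (n : ℕ) :
    ((F limB n).ncard : ℕ∞) ≤
      Dynamics.coverMincard shift (subshift limB) (cylinder 0) n := by
  classical
  refine le_iInf₂ fun s hs => ?_
  have hsub : F limB n ⊆
      (s.image fun y => List.ofFn (fun j : Fin n => y j) : Finset (List Letter)) := by
    intro x hx
    obtain ⟨z, hz, rfl⟩ := exists_mem_subshift hx
    obtain ⟨y, hy, hzy⟩ := hs hz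
    rw [mem_dynEntourage_cylinder] at hzy
    refine Finset.mem_coe.2 (Finset.mem_image.2 ⟨y, hy, ?_⟩)
    refine congrArg List.ofFn (funext fun j => ?_)
    simpa using (hzy j j.2 0 (by simp)).symm
  have h := Set.ncard_le_ncard hsub (Finset.finite_toSet _)
  rw [Set.ncard_coe_finset] at h
  exact_mod_cast h.trans Finset.card_image_le

theorem expGrowthSup_natCast {c : ℕ → ℕ} {h : ℝ} (hpos : ∀ n, 0 < c n)
    (hc : Filter.Tendsto (fun n => Real.log (c n) / n) Filter.atTop (nhds h)) :
    ExpGrowth.expGrowthSup (fun n => (c n : ENNReal)) = (h : EReal) := by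
  refine Filter.Tendsto.limsup_eq ?_
  refine ((continuous_coe_real_ereal.tendsto h).comp hc).congr fun n => ?_
  have h1 : ENNReal.log (c n : ENNReal) = (Real.log (c n) : EReal) := by
    rw [← ENNReal.ofReal_natCast, ENNReal.log_ofReal_of_pos (by exact_mod_cast hpos n)]
  simp only [Function.comp, h1, EReal.coe_div, EReal.coe_natCast]

theorem tendsto_log_ncard_F_add (d : ℕ) : Filter.Tendsto
    (fun n : ℕ => Real.log (F limB (n + d)).ncard / n) Filter.atTop
    (nhds (1 / Real.goldenRatio ^ 3 * Real.log 2)) := by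
  have h1 := tendsto_log_ncard_F.comp (Filter.tendsto_add_atTop_nat d)
  have h2 : Filter.Tendsto (fun n : ℕ => 1 + (d : ℝ) / n) Filter.atTop (nhds (1 + 0)) :=
    (tendsto_const_div_atTop_nhds_zero_nat _).const_add 1
  have h3 := h1.mul h2
  rw [add_zero, mul_one] at h3
  refine h3.congr' (Filter.eventually_atTop.2 ⟨1, fun n hn => ?_⟩)
  have hn' : (0 : ℝ) < n := by exact_mod_cast hn
  simp only [Function.comp]
  push_cast
  field_simp

theorem coverEntropy_subshift_limB : Dynamics.coverEntropy shift (subshift limB) =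
    ((1 / Real.goldenRatio ^ 3 * Real.log 2 : ℝ) : EReal) := by
  apply le_antisymm
  · refine iSup₂_le fun U hU => ?_
    obtain ⟨r, hr⟩ := exists_cylinder_subset hU
    refine (Dynamics.coverEntropyEntourage_antitone _ _ hr).trans ?_
    rw [← expGrowthSup_natCast (fun n => ncard_F_limB_pos (n + 2 * r))
      (tendsto_log_ncard_F_add (2 * r))]
    exact ExpGrowth.expGrowthSup_monotone fun n => by
      simpa using ENat.toENNReal_mono (coverMincard_cylinder_le limB r n)
  · refine le_trans ?_ (Dynamics.coverEntropyEntourage_le_coverEntropy _ _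
      cylinder_zero_mem_uniformity)
    rw [← expGrowthSup_natCast ncard_F_limB_pos tendsto_log_ncard_F]
    exact ExpGrowth.expGrowthSup_monotone fun n => by
      simpa using ENat.toENNReal_mono (ncard_F_le_coverMincard n)

end RandomFibonacci

theorem theorem1 :
    Filter.Tendsto
      (fun n : ℕ => Real.log ((RandomFibonacci.A n).ncard : ℝ) / (Nat.fib (2 * n) : ℝ))
      Filter.atTop (nhds (1 / Real.goldenRatio ^ 3 * Real.log 2)) ∧
    Filter.Tendsto
      (fun n : ℕ => Real.log ((RandomFibonacci.B n).ncard : ℝ) / (Nat.fib (2 * n - 1) : ℝ))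
      Filter.atTop (nhds (1 / Real.goldenRatio ^ 3 * Real.log 2)) ∧
    ∀ C ∈ ({RandomFibonacci.limA, RandomFibonacci.limB} : Set (Set (ℕ → RandomFibonacci.Letter))),
      Filter.Tendsto
        (fun n : ℕ => Real.log ((RandomFibonacci.F C n).ncard : ℝ) / (n : ℝ))
        Filter.atTop (nhds (1 / Real.goldenRatio ^ 3 * Real.log 2)) ∧
      Dynamics.coverEntropy RandomFibonacci.shift (RandomFibonacci.subshift C) =
        ((1 / Real.goldenRatio ^ 3 * Real.log 2 : ℝ) : EReal) := by
  refine ⟨RandomFibonacci.tendsto_log_ncard_A, RandomFibonacci.tendsto_log_ncard_B,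
    fun C hC => ?_⟩
  obtain rfl : C = RandomFibonacci.limB :=
    hC.elim (fun h => h.trans RandomFibonacci.limA_eq_limB) id
  exact ⟨RandomFibonacci.tendsto_log_ncard_F, RandomFibonacci.coverEntropy_subshift_limB⟩
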